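/- **Setting.** A unitary $U$ on $m$ ancilla qubits and an $N$-dimensional system is an $(\alpha,m,\epsilon)$-block encoding of $A\in\mathbb C^{N\times N}$ if $\|A-\alpha(\langle 0^m|\otimes I)U(|0^m\rangle\otimes I)\|\le\epsilon$ (spectral norm). For $A\in\mathbb C^{N\times N}$, a time $T>0$ and a unit vector $|\psi_0\rangle\in\mathbb C^N$, let $|\psi(t)\rangle=e^{tA}|\psi_0\rangle$ be the solution of $\frac{d}{dt}|\psi(t)\rangle=A|\psi(t)\rangle$, $|\psi(0)\rangle=|\psi_0\rangle$, and let $$Q(A,\psi_0,T)=\sup_{L}\ \sup_{0=t_0<t_1<\cdots<t_L=T}\ \frac{\prod_{l=0}^{L-1}\|e^{(t_{l+1}-t_l)A}\|}{\||\psi(T)\rangle\|}$$ be the amplification ratio. A quantum query algorithm with $q$ queries to a unitary $U$ starts in a fixed basis state of the register of $U$ together with a work register of arbitrary finite dimension, alternates $q+1$ arbitrary unitaries that do not depend on $U$ with $q$ applications of $U$ or $U^{-1}$, possibly controlled by the work register, and outputs the (in general mixed) reduced state $\rho$ of the $N$-dimensional system. The trace distance is $\mathcal D(\rho,\sigma)=\frac12\operatorname{Tr}\sqrt{(\rho-\sigma)^2}$.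 **Theorem.** For every $N\ge 2$ there are a time $T_N>0$ with $T_N=O(\log N)$, a unit vector $|\psi_{0,N}\rangle\in\mathbb C^N$ and a nonempty set $\mathcal A_N\subset\mathbb C^{N\times N}$ of matrices such that every $A\in\mathcal A_N$ has, for every $m\ge 0$, a $(1,m,0)$-block encoding $U_{A}=U_{A,m}$ and satisfies $Q(A,\psi_{0,N},T_N)=\sqrt{3N/4}$, and such that the following holds. For every $\theta>0$, every constant $C$ and every real polynomial $p$ there is $N_0$ such that for all $N\ge N_0$, all $m\ge 0$ and every quantum query algorithm (which may depend on $N$, $m$, $T_N$ and $\psi_{0,N}$, but accesses $A$ only through queries to $U_A$), there is a matrix $A\in\mathcal A_N$ for which it is not the case that the algorithm both makes at most $C\,Q(A,\psi_{0,N},T_N)^{1-\theta}\,p(T_N)$ queries and prepares, when run with oracle $U_A$, a state $\rho$ with $$\mathcal D\!\left(\frac{|\psi(T_N)\rangle\langle\psi(T_N)|}{\||\psi(T_N)\rangle\|^2},\ \rho\right)\le\frac12 ,\qquad |\psi(T_N)\rangle=e^{T_NA}|\psi_{0,N}\rangle .$$ In particular, no family of quantum algorithms that solves all these instances uses $O(Q^{1-\theta}\operatorname{poly}(T))$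 queries to $U_A$. -/

import Mathlib

open scoped Matrix.Norms.L2Operator MatrixOrder

noncomputable section

/-- Index set of the computational basis of `m` ancilla qubits together with an
`N`-dimensional system register. -/
abbrev OracleReg (m N : ℕ) : Type := (Fin m → Fin 2) × Fin N

/-- A unitary `U` on `m` ancilla qubits and an `N`-dimensional system is an
`(α, m, ε)`-block encoding of `A` if `‖A - α (⟨0^m| ⊗ I) U (|0^m⟩ ⊗ I)‖ ≤ ε` in spectral norm. -/
def IsBlockEncoding {m N : ℕ} (α ε : ℝ) (U : Matrix.unitaryGroup (OracleReg m N) ℂ)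
    (A : Matrix (Fin N) (Fin N) ℂ) : Prop :=
  ‖A - (α : ℂ) • (U : Matrix (OracleReg m N) (OracleReg m N) ℂ).submatrix
      (fun i : Fin N => ((0 : Fin m → Fin 2), i)) (fun j : Fin N => ((0 : Fin m → Fin 2), j))‖ ≤ ε

/-- The propagator `e^{tA}`. -/
def propagator {N : ℕ} (A : Matrix (Fin N) (Fin N) ℂ) (t : ℝ) : Matrix (Fin N) (Fin N) ℂ :=
  NormedSpace.exp ((t : ℂ) • A)

/-- The (unnormalized) value `e^{tA} ψ₀` at time `t` of the solution of `ψ' = A ψ`, `ψ(0) = ψ₀`. -/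
def odeSolution {N : ℕ} (A : Matrix (Fin N) (Fin N) ℂ) (ψ₀ : EuclideanSpace ℂ (Fin N)) (t : ℝ) :
    EuclideanSpace ℂ (Fin N) :=
  Matrix.toEuclideanLin (propagator A t) ψ₀

/-- The amplification ratio `Q`: the supremum over all meshes `0 = t_0 < t_1 < ⋯ < t_L = T` of
`∏_l ‖e^{(t_{l+1} - t_l) A}‖ / ‖ψ(T)‖`. -/
def amplificationRatio {N : ℕ} (A : Matrix (Fin N) (Fin N) ℂ) (ψ₀ : EuclideanSpace ℂ (Fin N))
    (T : ℝ) : ℝ :=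
  sSup {x : ℝ | ∃ (L : ℕ) (t : ℕ → ℝ), t 0 = 0 ∧ t L = T ∧ (∀ l < L, t l < t (l + 1)) ∧
    x = (∏ l ∈ Finset.range L, ‖propagator A (t (l + 1) - t l)‖) / ‖odeSolution A ψ₀ T‖}

/-- The density matrix `|ψ⟩⟨ψ| / ‖ψ‖²` of the quantum state proportional to `ψ`. -/
def pureState {N : ℕ} (ψ : EuclideanSpace ℂ (Fin N)) : Matrix (Fin N) (Fin N) ℂ :=
  Matrix.of fun i j => ψ i * star (ψ j) / ((‖ψ‖ ^ 2 : ℝ) : ℂ)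

/-- The trace distance `½ Tr √((ρ - σ)²)` of two density matrices. -/
def traceDistance {N : ℕ} (ρ σ : Matrix (Fin N) (Fin N) ℂ) : ℝ :=
  (1 / 2) * (Matrix.trace (CFC.sqrt ((ρ - σ) ^ 2))).re

/-- What one query may do, conditionally on a basis state of the work register:
nothing, apply the oracle, or apply its inverse. -/
inductive QueryMode
  | idle
  | forward
  | inverse

/-- The operator applied to the oracle register in a given mode. -/
def QueryMode.op {R : Type} [Fintype R] [DecidableEq R] (U : Matrix.unitaryGroup R ℂ) :
    QueryMode → Matrix R R ℂ
  | .idle => 1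
  | .forward => (U : Matrix R R ℂ)
  | .inverse => ((U⁻¹ : Matrix.unitaryGroup R ℂ) : Matrix R R ℂ)

/-- A quantum query algorithm for an oracle `U` acting on `OracleReg m N`. It has a work register
of arbitrary finite dimension `work`, starts in a computational basis state, and alternates
oracle-independent unitaries `gate 0, gate 1, …, gate queries` on the whole space with `queries`
queries. The `k`-th query applies, for each basis state `|a⟩` of the work register, the operator
`mode k a` to the oracle register: this covers `U`, `U⁻¹` and their controlled versions. -/
structure QueryAlgorithm (m N : ℕ) where
  queries : ℕ
  work : ℕ
  start : OracleReg m N × Fin work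
  gate : ℕ → Matrix.unitaryGroup (OracleReg m N × Fin work) ℂ
  mode : ℕ → Fin work → QueryMode

namespace QueryAlgorithm

variable {m N : ℕ} (alg : QueryAlgorithm m N) (U : Matrix.unitaryGroup (OracleReg m N) ℂ)

/-- The `k`-th query, `∑_a (op of mode k a) ⊗ |a⟩⟨a|`. -/
def queryOp (k : ℕ) :
    Matrix (OracleReg m N × Fin alg.work) (OracleReg m N × Fin alg.work) ℂ :=
  Matrix.blockDiagonal fun a => (alg.mode k a).op U

/-- The state vector after `k` queries, each query being followed by the next gate. -/
def stateAfter : ℕ → (OracleReg m N × Fin alg.work → ℂ)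
  | 0 => (alg.gate 0).1.mulVec (Pi.single alg.start 1)
  | k + 1 => (alg.gate (k + 1)).1.mulVec ((alg.queryOp U k).mulVec (stateAfter k))

/-- The (in general mixed) state prepared by the algorithm: the reduced density matrix on the
`N`-dimensional system register, all other registers being traced out. -/
def output : Matrix (Fin N) (Fin N) ℂ :=
  Matrix.of fun i j => ∑ b : Fin m → Fin 2, ∑ a : Fin alg.work,
    alg.stateAfter U alg.queries ((b, i), a) * star (alg.stateAfter U alg.queries ((b, j), a))

end QueryAlgorithm

end

/-! The hard instances hide an unstructured search. For the reflection `A = 2|x⟩⟨x| - 1`, which is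
unitary and so block-encodes itself, `e^{tA}` scales `|x⟩` by `e^t` and every other basis state by
`e^{-t}`. From the uniform state, a time `T` with `e^{4T} = 3(N-1)` gives `|x⟩` final probability
`3/4` (`pureState_odeSolution_marked`), so a preparation within trace distance `1/2` outputs `x`
with probability at least `1/4`. Since `‖e^{tA}‖ = e^t`, all meshes give the same product `e^T`, and
`Q = e^T / ‖ψ(T)‖ = √(3N/4)`.

The hybrid argument (`norm_stateAfter_sub_le`) compares each run with the one for the oracle `-1`,
which marks nothing. That single run spreads unit mass over all `x` at each query, so summing over
`x` forces `q = Ω(√N)` (`card_le_of_quarter_le_output`). As `T` is logarithmic in `N`, `Q^{1-θ}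
p(T)` is `o(√N)` (`eventually_query_bound_lt`), a contradiction. -/

/-! ### Trace distance -/

open scoped ComplexOrder in
/-- Measuring one basis state cannot distinguish two states better than their trace distance. -/
theorem diag_sub_diag_le_traceDistance {N : ℕ} {ρ σ : Matrix (Fin N) (Fin N) ℂ}
    (hρ : ρ.IsHermitian) (hσ : σ.IsHermitian) (htr : ρ.trace = σ.trace) (x : Fin N) :
    (ρ x x).re - (σ x x).re ≤ traceDistance ρ σ := by
  set M := ρ - σ with hM
  have hsa : IsSelfAdjoint M := hρ.sub hσ
  have habs : CFC.sqrt (M ^ 2) = CFC.abs M := by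
    rw [CFC.abs, hsa.star_eq, sq]
  -- `|M| ∓ M` is twice the negative, respectively positive, part of `M`, so the diagonal of `|M|`
  -- dominates that of `±M`.
  have h1 : (CFC.abs M - M).PosSemidef := by
    rw [CFC.abs_sub_self M hsa, ← Matrix.nonneg_iff_posSemidef]
    exact nsmul_nonneg (CFC.negPart_nonneg M) 2
  have h2 : (CFC.abs M + M).PosSemidef := by
    rw [CFC.abs_add_self M hsa, ← Matrix.nonneg_iff_posSemidef]
    exact nsmul_nonneg (CFC.posPart_nonneg M) 2
  have hx : (M x x).re ≤ (CFC.abs M x x).re := by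
    have := (Complex.le_def.1 (h1.diag_nonneg (i := x))).1
    simpa using this
  have hi : ∀ i, -(M i i).re ≤ (CFC.abs M i i).re := fun i => by
    have := (Complex.le_def.1 (h2.diag_nonneg (i := i))).1
    simp only [Complex.zero_re, Matrix.add_apply, Complex.add_re] at this
    linarith
  have htrM : ∑ i, (M i i).re = 0 := by
    have : M.trace = 0 := by rw [hM, Matrix.trace_sub, htr, sub_self]
    have := congrArg Complex.re this
    simpa [Matrix.trace] using this
  -- As `M` is traceless, its other diagonal entries sum to `-M x x`; hence `Tr |M| ≥ 2 M x x`, and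
  -- the factor `1/2` cancels.
  have hsum := Finset.sum_le_sum fun i (_ : i ∈ Finset.univ.erase x) => hi i
  rw [Finset.sum_neg_distrib] at hsum
  have e1 := Finset.add_sum_erase Finset.univ (fun i => (M i i).re) (Finset.mem_univ x)
  have e2 := Finset.add_sum_erase Finset.univ (fun i => (CFC.abs M i i).re) (Finset.mem_univ x)
  have e3 : (ρ x x).re - (σ x x).re = (M x x).re := by simp [hM]
  have e4 : (CFC.abs M).trace.re = ∑ i, (CFC.abs M i i).re := by simp [Matrix.trace]
  rw [traceDistance, ← hM, habs, e4, e3]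
  linarith

theorem isHermitian_pureState {N : ℕ} (ψ : EuclideanSpace ℂ (Fin N)) :
    (pureState ψ).IsHermitian := by
  ext i j
  simp only [pureState, Matrix.conjTranspose_apply, Matrix.of_apply, star_div₀, star_mul',
    star_star]
  rw [Complex.star_def, Complex.conj_ofReal, mul_comm]

theorem pureState_diag {N : ℕ} (ψ : EuclideanSpace ℂ (Fin N)) (i : Fin N) :
    pureState ψ i i = ((‖ψ i‖ ^ 2 / ‖ψ‖ ^ 2 : ℝ) : ℂ) := by
  simp [pureState, Complex.mul_conj, Complex.normSq_eq_norm_sq]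

theorem trace_pureState {N : ℕ} {ψ : EuclideanSpace ℂ (Fin N)} (hψ : ψ ≠ 0) :
    (pureState ψ).trace = 1 := by
  have : ‖ψ‖ ^ 2 ≠ 0 := by simpa using hψ
  simp only [Matrix.trace, Matrix.diag_apply, pureState_diag]
  rw [← Complex.ofReal_sum, ← Finset.sum_div, ← EuclideanSpace.norm_sq_eq, div_self this,
    Complex.ofReal_one]

/-! ### The hard instances -/

/-- The diagonal of the reflection fixing the basis state `x`. -/
noncomputable def markSign {N : ℕ} (x i : Fin N) : ℝ := if i = x then 1 else -1

/-- The reflection `2|x⟩⟨x| - 1`. -/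
noncomputable def markReflection {N : ℕ} (x : Fin N) : Matrix (Fin N) (Fin N) ℂ :=
  Matrix.diagonal fun i => (markSign x i : ℂ)

theorem markSign_mul_self {N : ℕ} (x i : Fin N) : markSign x i * markSign x i = 1 := by
  unfold markSign; split_ifs <;> norm_num

theorem markReflection_mem_unitaryGroup {N : ℕ} (x : Fin N) :
    markReflection x ∈ Matrix.unitaryGroup (Fin N) ℂ := by
  rw [Matrix.mem_unitaryGroup_iff, markReflection, Matrix.star_eq_conjTranspose,
    Matrix.diagonal_conjTranspose, Matrix.diagonal_mul_diagonal, ← Matrix.diagonal_one]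
  congr 1
  ext i
  simp [← Complex.ofReal_mul, markSign_mul_self]

open Classical in
/-- The unitary `1 ⊗ A` if `A` is unitary, and `1` otherwise. -/
noncomputable def tensorOracle (N m : ℕ) (A : Matrix (Fin N) (Fin N) ℂ) :
    Matrix.unitaryGroup (OracleReg m N) ℂ :=
  if hA : A ∈ Matrix.unitaryGroup (Fin N) ℂ then
    ⟨Matrix.kronecker 1 A, Matrix.kronecker_mem_unitary (one_mem _) hA⟩
  else 1

theorem isBlockEncoding_tensorOracle {N : ℕ} (m : ℕ) {A : Matrix (Fin N) (Fin N) ℂ}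
    (hA : A ∈ Matrix.unitaryGroup (Fin N) ℂ) :
    IsBlockEncoding 1 0 (tensorOracle N m A) A := by
  have : A - ((1 : ℝ) : ℂ) • (tensorOracle N m A : Matrix (OracleReg m N) (OracleReg m N) ℂ).submatrix
      (fun i : Fin N => ((0 : Fin m → Fin 2), i)) (fun j : Fin N => ((0 : Fin m → Fin 2), j)) = 0 := by
    ext i j
    simp [tensorOracle, hA, Matrix.kronecker]
  rw [IsBlockEncoding, this, norm_zero]

theorem tensorOracle_markReflection {N : ℕ} (m : ℕ) (x : Fin N) :
    (tensorOracle N m (markReflection x) : Matrix (OracleReg m N) (OracleReg m N) ℂ) =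
      Matrix.diagonal fun r => (markSign x r.2 : ℂ) := by
  rw [tensorOracle, dif_pos (markReflection_mem_unitaryGroup x)]
  change Matrix.kronecker _ (Matrix.diagonal _) = _
  rw [← Matrix.diagonal_one, Matrix.kronecker, Matrix.diagonal_kronecker_diagonal]
  simp

theorem propagator_markReflection {N : ℕ} (x : Fin N) (t : ℝ) :
    propagator (markReflection x) t =
      Matrix.diagonal fun i => (Real.exp (t * markSign x i) : ℂ) := by
  rw [propagator, markReflection, ← Matrix.diagonal_smul, Matrix.exp_diagonal]
  congr 1
  ext i
  rw [Pi.coe_exp, ← Complex.exp_eq_exp_ℂ]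
  simp

theorem norm_propagator_markReflection {N : ℕ} (x : Fin N) {t : ℝ} (ht : 0 ≤ t) :
    ‖propagator (markReflection x) t‖ = Real.exp t := by
  rw [propagator_markReflection, Matrix.l2_opNorm_diagonal]
  apply le_antisymm
  · rw [pi_norm_le_iff_of_nonneg (Real.exp_pos t).le]
    intro i
    rw [Complex.norm_real, Real.norm_of_nonneg (Real.exp_pos _).le, Real.exp_le_exp]
    unfold markSign; split_ifs <;> linarith
  · refine le_trans ?_ (norm_le_pi_norm _ x)
    rw [Complex.norm_real, Real.norm_of_nonneg (Real.exp_pos _).le, markSign, if_pos rfl, mul_one]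

/-- The uniform superposition. -/
noncomputable def uniformState (N : ℕ) : EuclideanSpace ℂ (Fin N) :=
  WithLp.toLp 2 fun _ => ((√N)⁻¹ : ℂ)

theorem norm_uniformState {N : ℕ} (hN : N ≠ 0) : ‖uniformState N‖ = 1 := by
  have : (N : ℝ) ≠ 0 := by exact_mod_cast hN
  rw [EuclideanSpace.norm_eq]
  simp [uniformState, abs_of_nonneg, this]

theorem norm_sq_odeSolution_apply {N : ℕ} (x : Fin N) (t : ℝ) (i : Fin N) :
    ‖odeSolution (markReflection x) (uniformState N) t i‖ ^ 2 =
      Real.exp (2 * t * markSign x i) / N := by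
  rw [odeSolution, propagator_markReflection]
  simp only [Matrix.toLpLin_apply, Matrix.mulVec_diagonal, uniformState, norm_mul, mul_pow]
  rw [Complex.norm_real, Real.norm_of_nonneg (Real.exp_pos _).le, ← Real.exp_nat_mul]
  simp [div_eq_mul_inv, mul_assoc]

theorem norm_sq_odeSolution {N : ℕ} (x : Fin N) (t : ℝ) :
    ‖odeSolution (markReflection x) (uniformState N) t‖ ^ 2 =
      (Real.exp (2 * t) + (N - 1) * Real.exp (-(2 * t))) / N := by
  rw [EuclideanSpace.norm_sq_eq]
  simp_rw [norm_sq_odeSolution_apply]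
  rw [← Finset.sum_div, ← Finset.add_sum_erase _ _ (Finset.mem_univ x)]
  congr 1
  have : ∀ i ∈ Finset.univ.erase x, Real.exp (2 * t * markSign x i) = Real.exp (-(2 * t)) := by
    intro i hi
    rw [markSign, if_neg (Finset.ne_of_mem_erase hi), mul_neg_one]
  have hN : 1 ≤ N := x.pos
  rw [Finset.sum_congr rfl this]
  simp [markSign, hN]

/-- The evolution time of the hard instances. -/
noncomputable def evolutionTime (N : ℕ) : ℝ := Real.log (3 * (N - 1)) / 4

theorem exp_evolutionTime {N : ℕ} (hN : 2 ≤ N) :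
    Real.exp (4 * evolutionTime N) = 3 * (N - 1) := by
  have : (2 : ℝ) ≤ N := by exact_mod_cast hN
  rw [evolutionTime, mul_div_cancel₀ _ (by norm_num), Real.exp_log (by linarith)]

theorem evolutionTime_pos {N : ℕ} (hN : 2 ≤ N) : 0 < evolutionTime N := by
  have : (2 : ℝ) ≤ N := by exact_mod_cast hN
  exact div_pos (Real.log_pos (by linarith)) (by norm_num)

theorem evolutionTime_le {N : ℕ} (hN : 2 ≤ N) : evolutionTime N ≤ 3 / 4 * Real.log N := by
  have : (2 : ℝ) ≤ N := by exact_mod_cast hN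
  have h : Real.log (3 * (N - 1)) ≤ Real.log ((N : ℝ) ^ 3) :=
    Real.log_le_log (by linarith) (by nlinarith [sq_nonneg ((N : ℝ) - 1)])
  rw [Real.log_pow] at h
  rw [evolutionTime]
  push_cast at h
  linarith

/-- At the evolution time, the growing term is three times the decaying one. -/
theorem exp_two_mul_evolutionTime {N : ℕ} (hN : 2 ≤ N) :
    (N - 1) * Real.exp (-(2 * evolutionTime N)) = Real.exp (2 * evolutionTime N) / 3 := by
  have h := exp_evolutionTime hN
  have h4 : Real.exp (4 * evolutionTime N) =
      Real.exp (2 * evolutionTime N) * Real.exp (2 * evolutionTime N) := by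
    rw [← Real.exp_add]; ring_nf
  have hpos := Real.exp_pos (2 * evolutionTime N)
  rw [Real.exp_neg]
  field_simp
  nlinarith

theorem norm_sq_odeSolution_evolutionTime {N : ℕ} (hN : 2 ≤ N) (x : Fin N) :
    ‖odeSolution (markReflection x) (uniformState N) (evolutionTime N)‖ ^ 2 =
      4 / 3 * (Real.exp (2 * evolutionTime N) / N) := by
  rw [norm_sq_odeSolution, exp_two_mul_evolutionTime hN]
  ring

theorem odeSolution_ne_zero {N : ℕ} (hN : 2 ≤ N) (x : Fin N) :
    odeSolution (markReflection x) (uniformState N) (evolutionTime N) ≠ 0 := by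
  have hN' : (0 : ℝ) < N := by positivity
  intro h
  have := norm_sq_odeSolution_evolutionTime hN x
  rw [h, norm_zero] at this
  have := Real.exp_pos (2 * evolutionTime N)
  have : 0 < 4 / 3 * (Real.exp (2 * evolutionTime N) / N) := by positivity
  linarith

theorem pureState_odeSolution_marked {N : ℕ} (hN : 2 ≤ N) (x : Fin N) :
    (pureState (odeSolution (markReflection x) (uniformState N) (evolutionTime N)) x x).re =
      3 / 4 := by
  have hN' : (N : ℝ) ≠ 0 := by positivity
  rw [pureState_diag, Complex.ofReal_re, norm_sq_odeSolution_apply,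
    norm_sq_odeSolution_evolutionTime hN, markSign, if_pos rfl, mul_one]
  have := (Real.exp_pos (2 * evolutionTime N)).ne'
  field_simp

theorem amplificationRatio_markReflection {N : ℕ} (hN : 2 ≤ N) (x : Fin N) :
    amplificationRatio (markReflection x) (uniformState N) (evolutionTime N) =
      √(3 * N / 4) := by
  have hN' : (0 : ℝ) < N := by positivity
  have hval : Real.exp (evolutionTime N) / ‖odeSolution (markReflection x) (uniformState N) (evolutionTime N)‖ =
      √(3 * N / 4) := by
    rw [eq_comm, Real.sqrt_eq_iff_eq_sq (by positivity) (by positivity), div_pow,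
      norm_sq_odeSolution_evolutionTime hN, ← Real.exp_nat_mul]
    have := (Real.exp_pos (2 * evolutionTime N)).ne'
    push_cast
    field_simp
  have hset : {y : ℝ | ∃ (L : ℕ) (t : ℕ → ℝ), t 0 = 0 ∧ t L = evolutionTime N ∧ (∀ l < L, t l < t (l + 1)) ∧
      y = (∏ l ∈ Finset.range L, ‖propagator (markReflection x) (t (l + 1) - t l)‖) /
        ‖odeSolution (markReflection x) (uniformState N) (evolutionTime N)‖} = {√(3 * N / 4)} := by
    ext y
    simp only [Set.mem_ofPred_eq, Set.mem_singleton_iff]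
    constructor
    · rintro ⟨L, t, h0, hL, hmono, rfl⟩
      -- The step norms are exactly `e^{t_{l+1} - t_l}`, so the product telescopes to `e^T` on every
      -- mesh.
      rw [Finset.prod_congr rfl fun l hl => norm_propagator_markReflection x
        (sub_nonneg.2 (hmono l (Finset.mem_range.1 hl)).le), ← Real.exp_sum,
        Finset.sum_range_sub, h0, hL, sub_zero, hval]
    · rintro rfl
      refine ⟨1, fun l => l * evolutionTime N, by simp, by simp, ?_, ?_⟩
      · intro l hl
        have := evolutionTime_pos hN
        push_cast
        linarith
      · simp only [Finset.prod_range_one, zero_add]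
        rw [Nat.cast_one, Nat.cast_zero, one_mul, zero_mul, sub_zero,
          norm_propagator_markReflection x (evolutionTime_pos hN).le, hval]
  rw [amplificationRatio, hset, csSup_singleton]

/-! ### Euclidean norm of amplitude vectors -/

theorem norm_toLp_unitary_mulVec {ι : Type*} [Fintype ι] [DecidableEq ι]
    (G : Matrix.unitaryGroup ι ℂ) (v : ι → ℂ) :
    ‖WithLp.toLp 2 (G.1.mulVec v)‖ = ‖WithLp.toLp 2 v‖ := by
  have key : ∀ (H : Matrix.unitaryGroup ι ℂ) (w : ι → ℂ),
      ‖WithLp.toLp 2 (H.1.mulVec w)‖ ≤ ‖WithLp.toLp 2 w‖ := fun H w => by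
    have h := Matrix.l2_opNorm_mulVec H.1 (WithLp.toLp 2 w)
    -- The C⋆-identity gives `‖H‖² = ‖1‖`, which is only `≤ 1` because `ι` may be empty.
    have h1 : ‖H.1‖ ≤ 1 := by
      have h2 := CStarRing.norm_star_mul_self (x := H.1)
      rw [Matrix.mem_unitaryGroup_iff'.1 H.2] at h2
      have h3 : ‖(1 : Matrix ι ι ℂ)‖ ≤ 1 := by
        rw [← Matrix.diagonal_one, Matrix.l2_opNorm_diagonal,
          pi_norm_le_iff_of_nonneg zero_le_one]
        simp
      nlinarith [norm_nonneg H.1]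
    exact h.trans (mul_le_of_le_one_left (norm_nonneg _) h1)
  refine le_antisymm (key G v) ?_
  have h := key G⁻¹ (G.1.mulVec v)
  have e : (G⁻¹).1 * G.1 = 1 := by
    rw [← Submonoid.coe_mul, inv_mul_cancel, Submonoid.coe_one]
  rwa [Matrix.mulVec_mulVec, e, Matrix.one_mulVec] at h

/-- The projection of an amplitude vector to the system basis state `x`. -/
def markProj {B W : Type*} {N : ℕ} (x : Fin N) (v : (B × Fin N) × W → ℂ) :
    (B × Fin N) × W → ℂ := fun r => if r.1.2 = x then v r else 0

/-- The squared norm of the component of `v` in which the system register is in state `x`. -/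
theorem norm_sq_markProj {B W : Type*} [Fintype B] [Fintype W] {N : ℕ}
    (v : (B × Fin N) × W → ℂ) (x : Fin N) :
    ‖WithLp.toLp 2 (markProj x v)‖ ^ 2 =
      ∑ b, ∑ a, ‖v ((b, x), a)‖ ^ 2 := by
  rw [EuclideanSpace.norm_sq_eq, Fintype.sum_prod_type, Fintype.sum_prod_type]
  refine Finset.sum_congr rfl fun b _ => ?_
  rw [Finset.sum_eq_single x]
  · simp [markProj]
  · intro i _ hi
    simp [markProj, hi]
  · simp

theorem sum_sq_norm_markProj {B W : Type*} [Fintype B] [Fintype W] {N : ℕ}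
    (v : (B × Fin N) × W → ℂ) :
    ∑ x, ‖WithLp.toLp 2 (markProj x v)‖ ^ 2 = ‖WithLp.toLp 2 v‖ ^ 2 := by
  simp only [norm_sq_markProj]
  rw [EuclideanSpace.norm_sq_eq, Fintype.sum_prod_type, Fintype.sum_prod_type, Finset.sum_comm]

theorem norm_markProj_le {B W : Type*} [Fintype B] [Fintype W] {N : ℕ} (x : Fin N)
    (v : (B × Fin N) × W → ℂ) :
    ‖WithLp.toLp 2 (markProj x v)‖ ≤ ‖WithLp.toLp 2 v‖ := by
  rw [← abs_of_nonneg (norm_nonneg (WithLp.toLp 2 v)),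
    ← abs_of_nonneg (norm_nonneg (WithLp.toLp 2 (markProj x v))), ← sq_le_sq,
    ← sum_sq_norm_markProj v]
  exact Finset.single_le_sum (f := fun x => ‖WithLp.toLp 2 (markProj x v)‖ ^ 2)
    (fun _ _ => sq_nonneg _) (Finset.mem_univ x)

theorem markProj_sub {B W : Type*} {N : ℕ} (x : Fin N) (v w : (B × Fin N) × W → ℂ) :
    markProj x (v - w) = markProj x v - markProj x w := by
  ext r
  simp only [markProj, Pi.sub_apply]
  split_ifs <;> simp

namespace QueryAlgorithm

variable {m N : ℕ} (alg : QueryAlgorithm m N)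

/-! ### Query algorithms with a diagonal oracle -/

/-- A query to a diagonal self-inverse oracle multiplies each amplitude by a sign or by `1`. -/
theorem queryOp_mulVec_diagonal {U : Matrix.unitaryGroup (OracleReg m N) ℂ}
    {d : OracleReg m N → ℝ} (hU : U.1 = Matrix.diagonal fun r => (d r : ℂ)) (k : ℕ)
    (v : OracleReg m N × Fin alg.work → ℂ) (r : OracleReg m N × Fin alg.work) :
    (alg.queryOp U k).mulVec v r =
      (match alg.mode k r.2 with
        | .idle => 1
        | _ => (d r.1 : ℂ)) * v r := by
  have hinv : (U⁻¹).1 = Matrix.diagonal fun r => (d r : ℂ) := by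
    change star U.1 = _
    rw [hU, Matrix.star_eq_conjTranspose, Matrix.diagonal_conjTranspose]
    congr 1
    ext r
    simp
  have hop : ∀ q : QueryMode, q.op U = Matrix.diagonal fun r => (match q with
        | .idle => (1 : ℂ)
        | _ => (d r : ℂ)) := by
    rintro (_ | _ | _)
    · simp [QueryMode.op]
    · exact hU
    · exact hinv
  rw [queryOp]
  simp_rw [hop]
  rw [Matrix.blockDiagonal_diagonal, Matrix.mulVec_diagonal]

theorem norm_queryOp_mulVec {U : Matrix.unitaryGroup (OracleReg m N) ℂ}
    {d : OracleReg m N → ℝ} (hU : U.1 = Matrix.diagonal fun r => (d r : ℂ))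
    (hd : ∀ r, |d r| = 1) (k : ℕ) (v : OracleReg m N × Fin alg.work → ℂ) :
    ‖WithLp.toLp 2 ((alg.queryOp U k).mulVec v)‖ = ‖WithLp.toLp 2 v‖ := by
  rw [EuclideanSpace.norm_eq, EuclideanSpace.norm_eq]
  congr 1
  refine Finset.sum_congr rfl fun r _ => ?_
  simp only [queryOp_mulVec_diagonal alg hU, norm_mul]
  split <;> simp [hd]

theorem norm_stateAfter {U : Matrix.unitaryGroup (OracleReg m N) ℂ}
    {d : OracleReg m N → ℝ} (hU : U.1 = Matrix.diagonal fun r => (d r : ℂ))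
    (hd : ∀ r, |d r| = 1) (k : ℕ) : ‖WithLp.toLp 2 (alg.stateAfter U k)‖ = 1 := by
  induction k with
  | zero =>
    rw [stateAfter, norm_toLp_unitary_mulVec]
    simp
  | succ k ih => rw [stateAfter, norm_toLp_unitary_mulVec, norm_queryOp_mulVec alg hU hd, ih]

/-- Hybrid argument: the states produced with two diagonal sign oracles that differ only where the
system register is in state `x` deviate by at most twice the amplitude queried at `x`. -/
theorem norm_stateAfter_sub_le {U V : Matrix.unitaryGroup (OracleReg m N) ℂ}
    {d e : OracleReg m N → ℝ} (hU : U.1 = Matrix.diagonal fun r => (d r : ℂ))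
    (hV : V.1 = Matrix.diagonal fun r => (e r : ℂ)) (hd : ∀ r, |d r| = 1) (he : ∀ r, |e r| = 1)
    {x : Fin N} (hde : ∀ r : OracleReg m N, r.2 ≠ x → d r = e r) (k : ℕ) :
    ‖WithLp.toLp 2 (alg.stateAfter U k - alg.stateAfter V k)‖ ≤
      ∑ j ∈ Finset.range k, 2 * ‖WithLp.toLp 2 (markProj x (alg.stateAfter V j))‖ := by
  induction k with
  | zero => simp [stateAfter]
  | succ k ih =>
    set u := alg.stateAfter U k
    set v := alg.stateAfter V k
    -- Away from `x` the two queries agree; at `x` two signs differ by at most `2`.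
    have hdiff : ‖WithLp.toLp 2 ((alg.queryOp U k).mulVec v - (alg.queryOp V k).mulVec v)‖ ≤
        2 * ‖WithLp.toLp 2 (markProj x v)‖ := by
      rw [← abs_of_nonneg (norm_nonneg (WithLp.toLp 2 (_ - _))),
        ← abs_of_nonneg (by positivity : 0 ≤ 2 * ‖WithLp.toLp 2 (markProj x v)‖), ← sq_le_sq,
        mul_pow, EuclideanSpace.norm_sq_eq, EuclideanSpace.norm_sq_eq, Finset.mul_sum]
      refine Finset.sum_le_sum fun r _ => ?_
      simp only [Pi.sub_apply, queryOp_mulVec_diagonal alg hU, queryOp_mulVec_diagonal alg hV,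
        ← sub_mul, norm_mul, mul_pow, markProj]
      by_cases hr : r.1.2 = x
      · rw [if_pos hr]
        gcongr
        split
        · simp
        · refine (norm_sub_le _ _).trans ?_
          simp only [Complex.norm_real, Real.norm_eq_abs, hd, he]
          norm_num
      · rw [if_neg hr, hde _ hr]
        split <;> simp
    -- Split `O_U u - O_V v = O_U (u - v) + (O_U - O_V) v`, so that only the `V`-state is projected:
    -- it will not depend on `x`.
    have hstep : ‖WithLp.toLp 2 (alg.stateAfter U (k + 1) - alg.stateAfter V (k + 1))‖ ≤
        ‖WithLp.toLp 2 (u - v)‖ + 2 * ‖WithLp.toLp 2 (markProj x v)‖ := by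
      rw [stateAfter, stateAfter, ← Matrix.mulVec_sub, norm_toLp_unitary_mulVec,
        ← norm_queryOp_mulVec alg hU hd k (u - v)]
      refine le_trans (le_of_eq ?_) ((norm_add_le _ _).trans (add_le_add le_rfl hdiff))
      rw [← WithLp.toLp_add, Matrix.mulVec_sub]
      congr 2
      abel
    rw [Finset.sum_range_succ]
    exact hstep.trans (add_le_add ih le_rfl)

theorem isHermitian_output (U : Matrix.unitaryGroup (OracleReg m N) ℂ) :
    (alg.output U).IsHermitian := by
  ext i j
  simp only [output, Matrix.conjTranspose_apply, Matrix.of_apply, star_sum, star_mul', star_star]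
  exact Finset.sum_congr rfl fun _ _ => Finset.sum_congr rfl fun _ _ => mul_comm _ _

theorem output_diag (U : Matrix.unitaryGroup (OracleReg m N) ℂ) (x : Fin N) :
    alg.output U x x =
      ((‖WithLp.toLp 2 (markProj x (alg.stateAfter U alg.queries))‖ ^ 2 : ℝ) : ℂ) := by
  rw [norm_sq_markProj]
  simp [output, Complex.mul_conj, Complex.normSq_eq_norm_sq]

theorem trace_output {U : Matrix.unitaryGroup (OracleReg m N) ℂ}
    {d : OracleReg m N → ℝ} (hU : U.1 = Matrix.diagonal fun r => (d r : ℂ))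
    (hd : ∀ r, |d r| = 1) : (alg.output U).trace = 1 := by
  simp only [Matrix.trace, Matrix.diag_apply, output_diag]
  rw [← Complex.ofReal_sum, sum_sq_norm_markProj, norm_stateAfter alg hU hd]
  simp

/-- The query lower bound for search: if with each oracle `U x`, which differs from a reference
sign oracle only at `x`, the output is `x` with probability at least `1 / 4`, then the number `q`
of queries satisfies `N ≤ 32 q ^ 2 + 8`. -/
theorem card_le_of_quarter_le_output {U : Fin N → Matrix.unitaryGroup (OracleReg m N) ℂ}
    {V : Matrix.unitaryGroup (OracleReg m N) ℂ} {d : Fin N → OracleReg m N → ℝ}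
    {e : OracleReg m N → ℝ} (hU : ∀ x, (U x).1 = Matrix.diagonal fun r => (d x r : ℂ))
    (hV : V.1 = Matrix.diagonal fun r => (e r : ℂ)) (hd : ∀ x r, |d x r| = 1)
    (he : ∀ r, |e r| = 1) (hde : ∀ x, ∀ r : OracleReg m N, r.2 ≠ x → d x r = e r)
    (hout : ∀ x, 1 / 4 ≤ (alg.output (U x) x x).re) :
    (N : ℝ) ≤ 32 * (alg.queries : ℝ) ^ 2 + 8 := by
  set q := alg.queries with hq
  set φ := alg.stateAfter V
  -- Constants from `(2S + b)² ≤ 8S² + 2b²`, then Cauchy–Schwarz `S² ≤ q ∑ ‖·‖²`.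
  have hx : ∀ x, 1 / 4 ≤
      8 * (q * ∑ j ∈ Finset.range q, ‖WithLp.toLp 2 (markProj x (φ j))‖ ^ 2) +
        2 * ‖WithLp.toLp 2 (markProj x (φ q))‖ ^ 2 := by
    intro x
    have h1 := hout x
    rw [output_diag, Complex.ofReal_re, ← hq] at h1
    have h2 := norm_stateAfter_sub_le alg (hU x) hV (hd x) he (hde x) q
    rw [← Finset.mul_sum] at h2
    have h3 : ‖WithLp.toLp 2 (markProj x (alg.stateAfter (U x) q))‖ ≤
        2 * (∑ j ∈ Finset.range q, ‖WithLp.toLp 2 (markProj x (φ j))‖) +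
          ‖WithLp.toLp 2 (markProj x (φ q))‖ := by
      have h4 := norm_markProj_le x (alg.stateAfter (U x) q - φ q)
      rw [markProj_sub, WithLp.toLp_sub] at h4
      have h5 := norm_sub_norm_le (WithLp.toLp 2 (markProj x (alg.stateAfter (U x) q)))
        (WithLp.toLp 2 (markProj x (φ q)))
      linarith
    have h6 := sq_sum_le_card_mul_sum_sq (s := Finset.range q)
      (f := fun j => ‖WithLp.toLp 2 (markProj x (φ j))‖)
    rw [Finset.card_range] at h6
    set S := ∑ j ∈ Finset.range q, ‖WithLp.toLp 2 (markProj x (φ j))‖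
    set b := ‖WithLp.toLp 2 (markProj x (φ q))‖
    have h7 := pow_le_pow_left₀ (norm_nonneg _) h3 2
    nlinarith [sq_nonneg (2 * S - b)]
  -- The projections of each reference state have total squared norm `1`, so summation gives `N/4 ≤
  -- 8q² + 2`.
  have hsum := Finset.sum_le_sum fun x (_ : x ∈ Finset.univ) => hx x
  rw [Finset.sum_add_distrib, ← Finset.mul_sum, ← Finset.mul_sum, ← Finset.mul_sum,
    Finset.sum_comm] at hsum
  simp only [sum_sq_norm_markProj, φ, norm_stateAfter alg hV he] at hsum
  simp at hsum
  nlinarith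

end QueryAlgorithm

/-! ### Asymptotics -/

open Filter Topology in
/-- A bound of the form `C * Q ^ (1 - θ) * poly (T)` is `o(√N)`. -/
theorem eventually_query_bound_lt {θ : ℝ} (hθ : 0 < θ) (C : ℝ) (p : Polynomial ℝ) :
    ∀ᶠ N : ℕ in atTop,
      |C * (√(3 * N / 4) ^ (1 - θ) * p.eval (evolutionTime N))| ≤ √(3 * N / 4) / 8 := by
  have hT : Tendsto (fun N : ℕ => 2 * θ * evolutionTime N) atTop atTop := by
    have h1 : Tendsto (fun N : ℕ => 3 * ((N : ℝ) - 1)) atTop atTop :=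
      (tendsto_atTop_add_const_right _ (-1) tendsto_natCast_atTop_atTop).const_mul_atTop
        (by norm_num)
    exact ((Real.tendsto_log_atTop.comp h1).atTop_div_const (by norm_num)).const_mul_atTop
      (by positivity)
  -- In the variable `2θT`, the rescaled polynomial is `p(T)` and the denominator `e^{2θT}`, which
  -- is at most `(2Q)^θ`; hence the factor `2^θ`.
  have hlim := ((Polynomial.tendsto_div_exp_atTop
    (p.comp (Polynomial.C (2 * θ)⁻¹ * Polynomial.X))).comp hT).const_mul (C * 2 ^ θ)
  rw [mul_zero] at hlim
  filter_upwards [(hlim.abs).eventually (ge_mem_nhds (by norm_num : |(0 : ℝ)| < 1 / 8)),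
    eventually_ge_atTop 2] with N hN hN2
  have hN0 : (0 : ℝ) < N := by positivity
  set Q := √(3 * N / 4) with hQ
  have hQ0 : 0 < Q := Real.sqrt_pos.2 (by positivity)
  have hT0 := exp_evolutionTime hN2
  simp only [Function.comp_apply] at hN
  set T := evolutionTime N
  have hexp : Real.exp (2 * θ * T) ≤ 2 ^ θ * Q ^ θ := by
    -- After squaring: `e^{4T} = 3(N-1) ≤ 3N = (2Q)²`.
    have h2 : Real.exp (2 * T) ≤ 2 * Q := by
      refine (sq_le_sq₀ (by positivity) (by positivity)).1 ?_
      rw [mul_pow, hQ, Real.sq_sqrt (by positivity), ← Real.exp_nat_mul]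
      have : ((2 : ℕ) : ℝ) * (2 * T) = 4 * T := by push_cast; ring
      rw [this, hT0]
      linarith
    calc Real.exp (2 * θ * T) = Real.exp (2 * T) ^ θ := by rw [← Real.exp_mul]; ring_nf
      _ ≤ (2 * Q) ^ θ := Real.rpow_le_rpow (Real.exp_pos _).le h2 hθ.le
      _ = 2 ^ θ * Q ^ θ := Real.mul_rpow (by norm_num) hQ0.le
  have heval : (p.comp (Polynomial.C (2 * θ)⁻¹ * Polynomial.X)).eval (2 * θ * T) = p.eval T := by
    rw [Polynomial.eval_comp, Polynomial.eval_mul, Polynomial.eval_C, Polynomial.eval_X,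
      inv_mul_cancel_left₀ (by positivity)]
  rw [heval] at hN
  have h2θ : (0 : ℝ) < 2 ^ θ := by positivity
  have hQθ : 0 < Q ^ θ := Real.rpow_pos_of_pos hQ0 θ
  rw [abs_mul, abs_mul, abs_div, Real.abs_exp, abs_of_pos h2θ] at hN
  have hkey : |C| * |p.eval T| ≤ Q ^ θ / 8 := by
    rw [mul_div_assoc', div_le_iff₀ (Real.exp_pos _)] at hN
    have h3 := hN.trans (mul_le_mul_of_nonneg_left hexp (by norm_num : (0 : ℝ) ≤ 1 / 8))
    have h4 : 2 ^ θ * (|C| * |p.eval T|) ≤ 2 ^ θ * (Q ^ θ / 8) := by linarith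
    exact le_of_mul_le_mul_left h4 h2θ
  rw [abs_mul, abs_mul, abs_of_pos (Real.rpow_pos_of_pos hQ0 _), Real.rpow_sub hQ0, Real.rpow_one]
  calc |C| * (Q / Q ^ θ * |p.eval T|) = Q / Q ^ θ * (|C| * |p.eval T|) := by ring
    _ ≤ Q / Q ^ θ * (Q ^ θ / 8) := by gcongr
    _ = Q / 8 := by field_simp

/-- Preparing the solution of every hard instance up to trace distance `1 / 2` requires
`Ω(√N)` queries. -/
theorem card_le_of_traceDistance_le {m N : ℕ} (hN : 2 ≤ N) (alg : QueryAlgorithm m N)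
    (h : ∀ x : Fin N, traceDistance
      (pureState (odeSolution (markReflection x) (uniformState N) (evolutionTime N)))
      (alg.output (tensorOracle N m (markReflection x))) ≤ 1 / 2) :
    (N : ℝ) ≤ 32 * (alg.queries : ℝ) ^ 2 + 8 := by
  have hsign : ∀ (x : Fin N) (r : OracleReg m N), |markSign x r.2| = 1 := fun x r => by
    unfold markSign; split_ifs <;> simp
  -- The reference oracle `-1` is the reflection with no marked state.
  refine alg.card_le_of_quarter_le_output (V := -1) (e := fun _ => -1)
    (fun x => tensorOracle_markReflection m x) ?_ hsign (by simp)
    (fun x r hr => by rw [markSign, if_neg hr]) fun x => ?_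
  · change -(1 : Matrix (OracleReg m N) (OracleReg m N) ℂ) = _
    rw [← Matrix.diagonal_one, Matrix.diagonal_neg]
    simp
  · have h1 := diag_sub_diag_le_traceDistance (isHermitian_pureState
      (odeSolution (markReflection x) (uniformState N) (evolutionTime N)))
      (alg.isHermitian_output (tensorOracle N m (markReflection x)))
      (by rw [trace_pureState (odeSolution_ne_zero hN x),
        alg.trace_output (tensorOracle_markReflection m x) (hsign x)]) x
    rw [pureState_odeSolution_marked hN] at h1
    linarith [h x]

theorem mainTheorem3 :
    ∃ (T : ℕ → ℝ) (ψ₀ : ∀ N : ℕ, EuclideanSpace ℂ (Fin N))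
      (𝒜 : ∀ N : ℕ, Set (Matrix (Fin N) (Fin N) ℂ))
      (UA : ∀ N m : ℕ, Matrix (Fin N) (Fin N) ℂ → Matrix.unitaryGroup (OracleReg m N) ℂ),
      (∃ c : ℝ, ∀ N : ℕ, 2 ≤ N → 0 < T N ∧ T N ≤ c * Real.log N) ∧
      (∀ N : ℕ, 2 ≤ N → ‖ψ₀ N‖ = 1) ∧
      (∀ N : ℕ, 2 ≤ N → (𝒜 N).Nonempty) ∧
      (∀ N : ℕ, 2 ≤ N → ∀ A ∈ 𝒜 N,
        (∀ m : ℕ, IsBlockEncoding 1 0 (UA N m A) A) ∧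
        amplificationRatio A (ψ₀ N) (T N) = Real.sqrt (3 * N / 4)) ∧
      ∀ (θ : ℝ), 0 < θ → ∀ (C : ℝ) (p : Polynomial ℝ), ∃ N₀ : ℕ, ∀ N : ℕ, N₀ ≤ N →
        ∀ (m : ℕ) (alg : QueryAlgorithm m N), ∃ A ∈ 𝒜 N,
          ¬ ((alg.queries : ℝ) ≤
                C * (amplificationRatio A (ψ₀ N) (T N) ^ (1 - θ) * p.eval (T N)) ∧
              traceDistance (pureState (odeSolution A (ψ₀ N) (T N)))
                (alg.output (UA N m A)) ≤ 1 / 2) := by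
  refine ⟨evolutionTime, uniformState, fun N => Set.range markReflection, tensorOracle,
    ⟨3 / 4, fun N hN => ⟨evolutionTime_pos hN, evolutionTime_le hN⟩⟩,
    fun N hN => norm_uniformState (by omega), fun N hN => ⟨_, ⟨0, by omega⟩, rfl⟩, ?_, ?_⟩
  · rintro N hN _ ⟨x, rfl⟩
    exact ⟨fun m => isBlockEncoding_tensorOracle m (markReflection_mem_unitaryGroup x),
      amplificationRatio_markReflection hN x⟩
  · intro θ hθ C p
    obtain ⟨N₀, hN₀⟩ := Filter.eventually_atTop.1 (eventually_query_bound_lt hθ C p)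
    -- With `q ≤ Q/8` the search bound reads `N ≤ 3N/8 + 8`, which fails once `N > 12.8`.
    refine ⟨max N₀ 14, fun N hN m alg => ?_⟩
    have hN14 : 14 ≤ N := (le_max_right _ _).trans hN
    have hN2 : 2 ≤ N := by omega
    have hbound := hN₀ N ((le_max_left _ _).trans hN)
    by_contra! hcon
    have hall : ∀ x : Fin N, _ := fun x => hcon (markReflection x) ⟨x, rfl⟩
    have hcard := card_le_of_traceDistance_le hN2 alg fun x => (hall x).2
    -- One instance suffices: neither the query count nor `Q` depends on `x`.
    have hq := (hall ⟨0, by omega⟩).1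
    rw [amplificationRatio_markReflection hN2] at hq
    have hq' : (alg.queries : ℝ) ≤ √(3 * N / 4) / 8 := hq.trans ((le_abs_self _).trans hbound)
    have hsq := pow_le_pow_left₀ (Nat.cast_nonneg _) hq' 2
    rw [div_pow, Real.sq_sqrt (by positivity)] at hsq
    have : (14 : ℝ) ≤ N := by exact_mod_cast hN14
    linarith
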